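/- For $s\ge 1$ let $\mathcal G_s$ be the set of multilinear polynomials $f\in\mathbb R[x_1,\dots,x_s]$ of degree at most $2$, all of whose coefficients lie in $\{0,1\}$ and whose constant term is $0$, and let $\mathcal G=\bigsqcup_{s\ge 1}\mathcal G_s$. For $f\in\mathcal G_s$ and $p\in[0,1]$ write $f(\vec\xi(p))=f(\xi_1,\dots,\xi_s)$, where $\xi_1,\dots,\xi_s$ are independent random variables, each equal to $1$ with probability $p$ and to $0$ with probability $1-p$. Then there exists $p\in(0,1/2]$, namely $p=1/3$, such that for every $f\in\mathcal G$ and every integer $\ell\ge 2$, $$\mathbb P\big[f(\vec\xi(p))=\ell\big]<0.3293<0.33.$$ -/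

import Mathlib

open MeasureTheory ProbabilityTheory

/-- `𝒢_s`: the multilinear polynomials of degree at most two in the variables `x_0, …, x_{s-1}`,
with real coefficients that all lie in `{0, 1}`, and with no constant term. -/
def quadPolys (s : ℕ) : Set (MvPolynomial (Fin s) ℝ) :=
  {f | f.totalDegree ≤ 2 ∧ (∀ i, f.degreeOf i ≤ 1) ∧
    (∀ d, f.coeff d = 0 ∨ f.coeff d = 1) ∧ f.coeff 0 = 0}

/-- `𝒢`: the disjoint union of the sets `𝒢_s` over all `s ≥ 1`. -/
def allQuadPolys : Set (Σ s : ℕ, MvPolynomial (Fin s) ℝ) :=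
  {f | 1 ≤ f.1 ∧ f.2 ∈ quadPolys f.1}

/-- The law on `ℝ^s` of a vector of `s` independent Bernoulli random variables, each of which
is `1` with probability `p` and `0` with probability `1 - p`. -/
noncomputable def bernoulliVector (s : ℕ) (p : unitInterval) : Measure (Fin s → ℝ) :=
  Measure.pi fun _ => bernoulliMeasure (1 : ℝ) 0 p

/-- `ℙ[f(ξ(p)) = ℓ]`, for a polynomial `f` in `s` variables and a vector `ξ(p)` of `s`
independent Bernoulli random variables with parameter `p`. -/
noncomputable def probEq {s : ℕ} (f : MvPolynomial (Fin s) ℝ) (p : unitInterval) (ℓ : ℝ) : ℝ :=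
  (bernoulliVector s p).real {x | MvPolynomial.eval x f = ℓ}

/-! At a 0/1 point, `f` counts the monomials whose variables all lie in the random set `S`: elements
of a set `A` of linear terms plus edges of a graph `G`. This count is monotone in `S`. Call a
variable active when adding it must raise the count, because it lies in `A` or has a neighbour
already present. Conditioned on all other variables, the event `f = ℓ` is an antichain in the active
ones, so by LYM its probability is at most the largest binomial weight. With five active variables
this is `80 / 243 < 0.3293`.

`IsQuad.cubeP_le` proves this bound by induction on the vertex set. A vertex outside `A` with no
neighbour in `A` is conditioned away: both outcomes are again of the same kind, with the same
target. A vertex whose presence makes five others active is handled by the antichain bound when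
present and by induction when absent. What remains has at most four linear terms and bounded
degrees, and is settled by cases on `#A`, with the weaker bound `4 / 9` (two active variables,
target at least 1) controlling the function once a linear term is fixed present. -/

open scoped Finset

set_option linter.unusedSectionVars false

/-! ### Random subsets of density 1/3 -/

section Cube

variable {α : Type*} [DecidableEq α]

/-- The expectation of `g S`, where `S` is a random subset of `V` that contains each element of `V`
independently with probability `1 / 3`. -/
noncomputable def cubeE (V : Finset α) (g : Finset α → ℝ) : ℝ :=
  ∑ S ∈ V.powerset, (1 / 3) ^ #S * (2 / 3) ^ (#V - #S) * g S

open Classical in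
/-- The probability that a random subset of `V` (each element being present with probability
`1 / 3`) satisfies `P`. -/
noncomputable def cubeP (V : Finset α) (P : Finset α → Prop) : ℝ :=
  cubeE V fun S => if P S then 1 else 0

/-- The weight of `k` under the binomial distribution with parameters `n` and `1 / 3`. -/
noncomputable def binomWeight (n k : ℕ) : ℝ :=
  n.choose k * (1 / 3) ^ k * (2 / 3) ^ (n - k)

lemma cubeE_congr {V : Finset α} {g h : Finset α → ℝ} (H : ∀ S ⊆ V, g S = h S) :
    cubeE V g = cubeE V h :=
  Finset.sum_congr rfl fun S hS => by rw [H S (Finset.mem_powerset.1 hS)]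

lemma cubeE_mono {V : Finset α} {g h : Finset α → ℝ} (H : ∀ S ⊆ V, g S ≤ h S) :
    cubeE V g ≤ cubeE V h :=
  Finset.sum_le_sum fun S hS =>
    mul_le_mul_of_nonneg_left (H S (Finset.mem_powerset.1 hS)) (by positivity)

lemma cubeE_add (V : Finset α) (g h : Finset α → ℝ) :
    cubeE V (fun S => g S + h S) = cubeE V g + cubeE V h := by
  simp [cubeE, mul_add, Finset.sum_add_distrib]

lemma cubeE_const_mul (V : Finset α) (c : ℝ) (g : Finset α → ℝ) :
    cubeE V (fun S => c * g S) = c * cubeE V g := by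
  simp only [cubeE, Finset.mul_sum]
  exact Finset.sum_congr rfl fun S _ => by ring

lemma cubeE_sum {ι : Type*} (V : Finset α) (s : Finset ι) (g : ι → Finset α → ℝ) :
    cubeE V (fun S => ∑ i ∈ s, g i S) = ∑ i ∈ s, cubeE V (g i) := by
  simp only [cubeE, Finset.mul_sum]
  exact Finset.sum_comm

lemma cubeE_empty (g : Finset α → ℝ) : cubeE ∅ g = g ∅ := by simp [cubeE]

lemma cubeE_insert {V : Finset α} {v : α} (hv : v ∉ V) (g : Finset α → ℝ) :
    cubeE (insert v V) g = 1 / 3 * cubeE V (fun S => g (insert v S)) + 2 / 3 * cubeE V g := by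
  rw [cubeE, Finset.sum_powerset_insert hv, add_comm]
  simp only [cubeE, Finset.mul_sum]
  congr 1
  · refine Finset.sum_congr rfl fun S hS => ?_
    have hS := Finset.mem_powerset.1 hS
    rw [Finset.card_insert_of_notMem hv, Finset.card_insert_of_notMem (fun h => hv (hS h)),
      Nat.add_sub_add_right]
    ring
  · refine Finset.sum_congr rfl fun S hS => ?_
    have hS := Finset.card_le_card (Finset.mem_powerset.1 hS)
    rw [Finset.card_insert_of_notMem hv, Nat.succ_sub hS, pow_succ]
    ring

lemma cubeE_union {U V : Finset α} (h : Disjoint U V) (g : Finset α → ℝ) :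
    cubeE (U ∪ V) g = cubeE V fun T => cubeE U fun R => g (T ∪ R) := by
  induction V using Finset.induction_on generalizing g with
  | empty => simp [cubeE_empty]
  | insert v V hv ih =>
    rw [Finset.disjoint_insert_right] at h
    rw [Finset.union_insert, cubeE_insert (by simp [h.1, hv]), cubeE_insert hv, ih h.2, ih h.2]
    simp only [Finset.insert_union]

lemma cubeE_card (V : Finset α) (φ : ℕ → ℝ) :
    cubeE V (fun S => φ #S) = ∑ k ∈ Finset.range (#V + 1), binomWeight #V k * φ k := by
  rw [cubeE, Finset.sum_powerset_apply_card fun k => (1 / 3 : ℝ) ^ k * (2 / 3) ^ (#V - k) * φ k]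
  exact Finset.sum_congr rfl fun k _ => by rw [binomWeight, nsmul_eq_mul]; ring

lemma cubeE_const (V : Finset α) (c : ℝ) : cubeE V (fun _ => c) = c := by
  induction V using Finset.induction_on with
  | empty => rw [cubeE_empty]
  | insert v V hv ih => rw [cubeE_insert hv, ih]; ring

lemma cubeE_le {V : Finset α} {g : Finset α → ℝ} {c : ℝ} (H : ∀ S ⊆ V, g S ≤ c) :
    cubeE V g ≤ c :=
  (cubeE_mono H).trans_eq (cubeE_const V c)

lemma cubeP_mono {V : Finset α} {P Q : Finset α → Prop} (H : ∀ S ⊆ V, P S → Q S) :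
    cubeP V P ≤ cubeP V Q := by
  refine cubeE_mono fun S hS => ?_
  have := H S hS
  split_ifs <;> simp_all

lemma cubeP_eq_zero {V : Finset α} {P : Finset α → Prop} (H : ∀ S ⊆ V, ¬ P S) :
    cubeP V P = 0 := by
  rw [cubeP, cubeE_congr (h := fun _ => 0) fun S hS => if_neg (H S hS), cubeE_const]

lemma cubeP_le_one (V : Finset α) (P : Finset α → Prop) : cubeP V P ≤ 1 :=
  cubeE_le fun S _ => by split_ifs <;> norm_num

lemma cubeP_nonneg (V : Finset α) (P : Finset α → Prop) : 0 ≤ cubeP V P :=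
  (cubeE_const V 0).symm.trans_le (cubeE_mono fun S _ => by split_ifs <;> norm_num)

lemma cubeP_insert {V : Finset α} {v : α} (hv : v ∉ V) (P : Finset α → Prop) :
    cubeP (insert v V) P = 1 / 3 * cubeP V (fun S => P (insert v S)) + 2 / 3 * cubeP V P :=
  cubeE_insert hv _

lemma cubeP_union {U V : Finset α} (h : Disjoint U V) (P : Finset α → Prop) :
    cubeP (U ∪ V) P = cubeE V fun T => cubeP U fun R => P (T ∪ R) :=
  cubeE_union h _

lemma cubeP_or_le (V : Finset α) (P Q : Finset α → Prop) :
    cubeP V (fun S => P S ∨ Q S) ≤ cubeP V P + cubeP V Q := by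
  rw [cubeP, cubeP, cubeP, ← cubeE_add]
  refine cubeE_mono fun S _ => ?_
  by_cases hP : P S <;> by_cases hQ : Q S <;> simp [hP, hQ]

open Classical in
lemma cubeP_eq_sum_filter (V : Finset α) (P : Finset α → Prop) :
    cubeP V P = ∑ S ∈ V.powerset with P S, (1 / 3 : ℝ) ^ #S * (2 / 3) ^ (#V - #S) := by
  rw [cubeP, cubeE, Finset.sum_filter]
  exact Finset.sum_congr rfl fun S _ => by split_ifs <;> simp

lemma cubeP_mem_le {V : Finset α} (F : Finset (Finset α)) (k : ℕ) (hF : ∀ S ∈ F, #S = k) :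
    cubeP V (· ∈ F) ≤ #F * ((1 / 3) ^ k * (2 / 3) ^ (#V - k)) := by
  classical
  rw [cubeP_eq_sum_filter, ← nsmul_eq_mul]
  refine (Finset.sum_le_card_nsmul _ _ ((1 / 3 : ℝ) ^ k * (2 / 3) ^ (#V - k)) ?_).trans ?_
  · intro S hS
    simp only [Finset.mem_filter] at hS
    rw [hF S hS.2]
  · refine nsmul_le_nsmul_left (by positivity) (Finset.card_le_card fun S hS => ?_)
    simp only [Finset.mem_filter] at hS
    exact hS.2

/-! ### Binomial weights and antichains -/

lemma binomWeight_zero_right (n : ℕ) : binomWeight n 0 = (2 / 3) ^ n := by simp [binomWeight]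

lemma binomWeight_nonneg (n k : ℕ) : 0 ≤ binomWeight n k := by unfold binomWeight; positivity

lemma binomWeight_succ_succ (n k : ℕ) :
    binomWeight (n + 1) (k + 1) = 1 / 3 * binomWeight n k + 2 / 3 * binomWeight n (k + 1) := by
  unfold binomWeight
  rw [Nat.choose_succ_succ, Nat.add_sub_add_right]
  rcases lt_or_ge k n with h | h
  · obtain ⟨m, rfl⟩ := Nat.exists_eq_add_of_lt h
    rw [show k + m + 1 - k = m + 1 by omega, show k + m + 1 - (k + 1) = m by omega]
    push_cast
    ring
  · rw [Nat.choose_eq_zero_of_lt (Nat.lt_succ_of_le h)]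
    push_cast
    ring

lemma binomWeight_eq_zero {n k : ℕ} (h : n < k) : binomWeight n k = 0 := by
  simp [binomWeight, Nat.choose_eq_zero_of_lt h]

/-- By Pascal's rule each weight at `n + 1` is at most a convex combination of weights at `n`, so a
uniform bound persists as `n` grows. -/
lemma binomWeight_le_of_le {m n : ℕ} (hmn : m ≤ n) {c : ℝ} (hm : ∀ k ≤ m, binomWeight m k ≤ c)
    (k : ℕ) : binomWeight n k ≤ c := by
  induction n, hmn using Nat.le_induction generalizing k with
  | base =>
    rcases le_or_gt k m with h | h
    · exact hm k h
    · rw [binomWeight_eq_zero h]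
      exact (binomWeight_nonneg m 0).trans (hm 0 m.zero_le)
  | succ n _ ih =>
    cases k with
    | zero =>
      rw [binomWeight_zero_right, pow_succ, ← binomWeight_zero_right]
      linarith [ih 0, binomWeight_nonneg n 0]
    | succ k =>
      rw [binomWeight_succ_succ]
      linarith [ih k, ih (k + 1)]

lemma binomWeight_le_of_five_le {n : ℕ} (hn : 5 ≤ n) (k : ℕ) : binomWeight n k ≤ 80 / 243 := by
  refine binomWeight_le_of_le hn (fun k hk => ?_) k
  interval_cases k <;> norm_num [binomWeight, Nat.choose]

lemma binomWeight_le_of_two_le {n : ℕ} (hn : 2 ≤ n) (k : ℕ) : binomWeight n k ≤ 4 / 9 := by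
  refine binomWeight_le_of_le hn (fun k hk => ?_) k
  interval_cases k <;> norm_num [binomWeight, Nat.choose]

/-- The LYM inequality for an antichain of subsets of a finite set. -/
lemma sum_inv_choose_le_one_of_isAntichain {V : Finset α} {F : Finset (Finset α)}
    (hFV : ∀ S ∈ F, S ⊆ V) (hF : IsAntichain (· ⊆ ·) (F : Set (Finset α))) :
    ∑ S ∈ F, ((#V).choose #S : ℝ)⁻¹ ≤ 1 := by
  let e : V ↪ α := Function.Embedding.subtype _
  let F' : Finset (Finset V) := Finset.univ.filter fun S => S.map e ∈ F
  have hF' : IsAntichain (· ⊆ ·) (F' : Set (Finset V)) := by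
    intro S hS T hT hne hST
    simp only [F', Finset.coe_filter, Finset.mem_univ, true_and, Set.mem_ofPred_eq] at hS hT
    exact hF hS hT (fun h => hne (Finset.map_injective e h)) (Finset.map_subset_map.2 hST)
  have key := Finset.lubell_yamamoto_meshalkin_inequality_sum_inv_choose (𝕜 := ℝ) hF'
  rw [Fintype.card_coe] at key
  refine le_trans (le_of_eq ?_) key
  symm
  refine Finset.sum_bij (fun S _ => S.map e) ?_ ?_ ?_ ?_
  · intro S hS
    exact (Finset.mem_filter.1 hS).2
  · intro S _ T _ h
    exact Finset.map_injective e h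
  · intro S hS
    have : (S.subtype (· ∈ V)).map e = S := by
      rw [Finset.subtype_map]
      exact Finset.filter_true_of_mem fun x hx => hFV S hS hx
    exact ⟨S.subtype (· ∈ V), Finset.mem_filter.2 ⟨Finset.mem_univ _, by rwa [this]⟩, this⟩
  · intro S _
    rw [Finset.card_map]

open Classical in
/-- A bound for the probability of an antichain that distinguishes its members of size at most
one. -/
lemma cubeP_le_of_isAntichain_of_small {V : Finset α} {P : Finset α → Prop}
    (hP : IsAntichain (· ⊆ ·) {S | S ⊆ V ∧ P S}) {c : ℝ} (hc : 0 ≤ c)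
    (hcb : ∀ k, 2 ≤ k → binomWeight #V k ≤ c) :
    cubeP V P ≤ c + (binomWeight #V 0 - c) * (if P ∅ then 1 else 0) +
      (binomWeight #V 1 - c) / #V * ∑ i ∈ V, if P {i} then 1 else 0 := by
  set F := V.powerset.filter P with hFdef
  have hFV : ∀ S ∈ F, S ⊆ V := fun S hS => Finset.mem_powerset.1 (Finset.mem_filter.1 hS).1
  have hlym : ∑ S ∈ F, ((#V).choose #S : ℝ)⁻¹ ≤ 1 :=
    sum_inv_choose_le_one_of_isAntichain hFV (hP.subset fun S hS =>
      ⟨hFV S hS, (Finset.mem_filter.1 hS).2⟩)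
  -- Each set weighs its binomial weight divided by the binomial coefficient. Sizes at least 2 are
  -- charged at rate `c`, for LYM to sum; the excess for `∅` and singletons is recorded exactly.
  have hterm : ∀ S ∈ F, (1 / 3 : ℝ) ^ #S * (2 / 3) ^ (#V - #S) ≤
      c * ((#V).choose #S : ℝ)⁻¹ + (binomWeight #V 0 - c) * (if S = ∅ then 1 else 0) +
        (binomWeight #V 1 - c) / #V * ∑ i ∈ V, if S = {i} then 1 else 0 := by
    intro S hS
    have hcard := Finset.card_le_card (hFV S hS)
    have hpos : (0 : ℝ) < (#V).choose #S := by exact_mod_cast Nat.choose_pos hcard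
    have hw : (1 / 3 : ℝ) ^ #S * (2 / 3) ^ (#V - #S) =
        binomWeight #V #S * ((#V).choose #S : ℝ)⁻¹ := by
      rw [binomWeight]
      field_simp
    rw [hw]
    rcases lt_trichotomy #S 1 with h | h | h
    · obtain rfl : S = ∅ := Finset.card_eq_zero.1 (by omega)
      simp
    · obtain ⟨i, rfl⟩ := Finset.card_eq_one.1 h
      have hi : i ∈ V := by simpa using hFV _ hS
      have : (#V : ℝ) ≠ 0 := by
        exact_mod_cast (Finset.card_pos.2 ⟨i, hi⟩).ne'
      simp only [Finset.card_singleton, Nat.choose_one_right, Finset.singleton_ne_empty, if_false,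
        Finset.singleton_inj, Finset.sum_ite_eq, hi, if_true]
      field_simp
      linarith
    · have h0 : S ≠ ∅ := by rintro rfl; simp at h
      have h1 : ∀ i ∈ V, S ≠ {i} := by rintro i - rfl; simp at h
      rw [if_neg h0, Finset.sum_congr rfl fun i hi => if_neg (h1 i hi)]
      simpa using mul_le_mul_of_nonneg_right (hcb #S h) (inv_nonneg.2 hpos.le)
  rw [cubeP_eq_sum_filter]
  refine (Finset.sum_le_sum hterm).trans ?_
  rw [Finset.sum_add_distrib, Finset.sum_add_distrib, ← Finset.mul_sum, ← Finset.mul_sum,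
    ← Finset.mul_sum, Finset.sum_comm]
  have e0 : ∑ S ∈ F, (if S = ∅ then (1 : ℝ) else 0) = if P ∅ then 1 else 0 := by
    rw [Finset.sum_ite_eq']
    simp [hFdef]
  have e1 : ∑ i ∈ V, ∑ S ∈ F, (if S = {i} then (1 : ℝ) else 0) =
      ∑ i ∈ V, if P {i} then 1 else 0 := by
    refine Finset.sum_congr rfl fun i hi => ?_
    rw [Finset.sum_ite_eq']
    simp [hFdef, hi]
  rw [e0, e1]
  nlinarith

open Classical in
lemma cubeP_le_of_isAntichain {V : Finset α} {P : Finset α → Prop}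
    (hP : IsAntichain (· ⊆ ·) {S | S ⊆ V ∧ P S}) {c : ℝ}
    (hcb : ∀ k, binomWeight #V k ≤ c) : cubeP V P ≤ c := by
  have h := cubeP_le_of_isAntichain_of_small hP ((binomWeight_nonneg _ _).trans (hcb 0))
    fun k _ => hcb k
  refine h.trans ?_
  have h0 : (binomWeight #V 0 - c) * (if P ∅ then 1 else 0) ≤ 0 :=
    mul_nonpos_of_nonpos_of_nonneg (by linarith [hcb 0]) (by split_ifs <;> norm_num)
  have h1 : (binomWeight #V 1 - c) / #V * (∑ i ∈ V, if P {i} then 1 else 0) ≤ 0 :=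
    mul_nonpos_of_nonpos_of_nonneg
      (div_nonpos_of_nonpos_of_nonneg (by linarith [hcb 1]) (by positivity))
      (Finset.sum_nonneg fun i _ => by split_ifs <;> norm_num)
  linarith

end Cube

/-! ### Linear terms plus edges of a graph -/

section Quad

variable {α : Type*} [DecidableEq α] {G : SimpleGraph α} [DecidableRel G.Adj]

/-- On subsets `S` of `V`, the function `f` is, up to an additive constant, the number of elements
of `A` in `S` plus the number of edges of `G` inside `S`. -/
structure IsQuad (G : SimpleGraph α) [DecidableRel G.Adj] (V A : Finset α) (f : Finset α → ℕ) :
    Prop where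
  subset : A ⊆ V
  insert : ∀ S ⊆ V, ∀ v ∈ V, v ∉ S →
    f (insert v S) = f S + (if v ∈ A then 1 else 0) + #{u ∈ S | G.Adj v u}

namespace IsQuad

variable {V A : Finset α} {f : Finset α → ℕ}

lemma restrict (h : IsQuad G V A f) {W : Finset α} (hW : W ⊆ V) :
    IsQuad G W {u ∈ W | u ∈ A} f where
  subset := Finset.filter_subset _ _
  insert S hS v hv hvS := by
    rw [h.insert S (hS.trans hW) v (hW hv) hvS]
    simp [hv]

lemma apply_singleton (h : IsQuad G V A f) {v : α} (hv : v ∈ V) :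
    f {v} = f ∅ + if v ∈ A then 1 else 0 := by
  have := h.insert ∅ (Finset.empty_subset _) v hv (Finset.notMem_empty _)
  simpa using this

/-- Fixing `v` to be present turns the neighbours of `v` into linear terms. -/
lemma link (h : IsQuad G V A f) {W : Finset α} (hW : W ⊆ V) {v : α} (hv : v ∈ V) (hvW : v ∉ W)
    (hA : ∀ u ∈ W, u ∈ A → ¬ G.Adj v u) :
    IsQuad G W {u ∈ W | u ∈ A ∨ G.Adj v u} (fun S => f (Insert.insert v S)) where
  subset := Finset.filter_subset _ _
  insert S hS u hu huS := by
    have huv : u ≠ v := fun e => hvW (e ▸ hu)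
    have hvS : v ∉ S := fun e => hvW (hS e)
    rw [Finset.insert_comm, h.insert (Insert.insert v S)
      (Finset.insert_subset hv (hS.trans hW)) u (hW hu) (by simp [huv, huS])]
    have hAu := hA u hu
    simp only [Finset.filter_insert, G.adj_comm u v]
    by_cases h1 : G.Adj v u
    · have h2 : u ∉ A := fun e => hAu e h1
      simp only [h1, h2, hu, if_true, if_false, Finset.mem_filter, or_true, and_true]
      rw [Finset.card_insert_of_notMem (by simp [hvS])]
      ring
    · simp [h1, hu]

lemma le_insert (h : IsQuad G V A f) {S : Finset α} (hS : S ⊆ V) {v : α} (hv : v ∈ V) :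
    f S ≤ f (Insert.insert v S) := by
  by_cases hvS : v ∈ S
  · rw [Finset.insert_eq_of_mem hvS]
  · rw [h.insert S hS v hv hvS]
    omega

lemma mono (h : IsQuad G V A f) {S T : Finset α} (hST : S ⊆ T) (hT : T ⊆ V) : f S ≤ f T := by
  obtain ⟨R, rfl⟩ : ∃ R, T = R ∪ S := ⟨T, (Finset.union_eq_left.2 hST).symm⟩
  clear hST
  induction R using Finset.induction_on with
  | empty => simp
  | insert v R hv ih =>
    rw [Finset.insert_union] at hT ⊢
    obtain ⟨h1, h2⟩ := Finset.insert_subset_iff.1 hT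
    exact (ih h2).trans (h.le_insert h2 h1)

lemma lt_insert (h : IsQuad G V A f) {S : Finset α} (hS : S ⊆ V) {v : α} (hv : v ∈ V)
    (hvS : v ∉ S) (hact : v ∈ A ∨ ∃ u ∈ S, G.Adj v u) : f S < f (Insert.insert v S) := by
  rw [h.insert S hS v hv hvS]
  rcases hact with hact | ⟨u, hu, hvu⟩
  · simp [hact]
    omega
  · have : 0 < #{u ∈ S | G.Adj v u} := Finset.card_pos.2 ⟨u, by simp [hu, hvu]⟩
    omega

/-- The elements of `U` being active once `T` is present, `f` is strictly monotone in them. -/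
lemma isAntichain (h : IsQuad G V A f) {T U : Finset α} (hT : T ⊆ V) (hU : U ⊆ V)
    (hTU : Disjoint T U) (hact : ∀ v ∈ U, v ∈ A ∨ ∃ u ∈ T, G.Adj v u) (L : ℕ) :
    IsAntichain (· ⊆ ·) {R | R ⊆ U ∧ f (T ∪ R) = L} := by
  rintro R ⟨hR, hfR⟩ R' ⟨hR', hfR'⟩ hne hsub
  obtain ⟨v, hv', hv⟩ := Finset.exists_of_ssubset (hsub.ssubset_of_ne hne)
  have hvT : v ∉ T := fun e => Finset.disjoint_left.1 hTU e (hR' hv')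
  have h1 : f (T ∪ R) < f (Insert.insert v (T ∪ R)) := by
    refine h.lt_insert (Finset.union_subset hT (hR.trans hU)) (hU (hR' hv')) (by simp [hvT, hv]) ?_
    rcases hact v (hR' hv') with h0 | ⟨u, hu, hvu⟩
    · exact Or.inl h0
    · exact Or.inr ⟨u, Finset.mem_union_left _ hu, hvu⟩
  have h2 : f (Insert.insert v (T ∪ R)) ≤ f (T ∪ R') := by
    refine h.mono ?_ (Finset.union_subset hT (hR'.trans hU))
    exact Finset.insert_subset (Finset.mem_union_right _ hv') (Finset.union_subset_union_right hsub)
  have := hfR.trans hfR'.symm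
  omega

/-- Condition on the coordinates of `W` outside `U`: whatever they are, `A` and `X` keep every
element of `U` active, so the antichain bound applies on each fibre. -/
lemma cubeP_le_of_active (h : IsQuad G V A f) {X W U : Finset α} (hX : X ⊆ V) (hW : W ⊆ V)
    (hXW : Disjoint X W) (hUW : U ⊆ W) (hact : ∀ v ∈ U, v ∈ A ∨ ∃ u ∈ X, G.Adj v u)
    {c : ℝ} (hc : ∀ k, binomWeight #U k ≤ c) (L : ℕ) :
    cubeP W (fun S => f (X ∪ S) = L) ≤ c := by
  have hd : Disjoint U (W \ U) := Finset.disjoint_sdiff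
  rw [← Finset.union_sdiff_of_subset hUW, cubeP_union hd]
  refine cubeE_le fun T hT => ?_
  have hTW : T ⊆ W := hT.trans Finset.sdiff_subset
  have hTU : Disjoint T U := (Finset.disjoint_of_subset_right hT hd).symm
  simp only [← Finset.union_assoc]
  refine cubeP_le_of_isAntichain (h.isAntichain (Finset.union_subset hX (hTW.trans hW))
    (hUW.trans hW) ?_ ?_ L) hc
  · exact Finset.disjoint_union_left.2 ⟨Finset.disjoint_of_subset_right hUW hXW, hTU⟩
  · intro v hv
    rcases hact v hv with h0 | ⟨u, hu, hvu⟩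
    · exact Or.inl h0
    · exact Or.inr ⟨u, Finset.mem_union_left _ hu, hvu⟩

/-- The handshake lemma. -/
lemma two_mul_eq (h : IsQuad G V A f) {T : Finset α} (hT : T ⊆ V) (hTA : ∀ v ∈ T, v ∉ A) :
    2 * f T = 2 * f ∅ + ∑ v ∈ T, #{u ∈ T | G.Adj v u} := by
  induction T using Finset.induction_on with
  | empty => simp
  | insert v T hv ih =>
    obtain ⟨h1, h2⟩ := Finset.insert_subset_iff.1 hT
    have ih := ih h2 fun u hu => hTA u (Finset.mem_insert_of_mem hu)
    have hvA := hTA v (Finset.mem_insert_self _ _)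
    rw [h.insert T h2 v h1 hv, if_neg hvA, Finset.sum_insert hv, Finset.filter_insert,
      if_neg (G.loopless.irrefl v)]
    have : ∑ u ∈ T, #{w ∈ Insert.insert v T | G.Adj u w} =
        ∑ u ∈ T, #{w ∈ T | G.Adj u w} + #{u ∈ T | G.Adj v u} := by
      rw [Finset.card_filter (fun u => G.Adj v u), ← Finset.sum_add_distrib]
      refine Finset.sum_congr rfl fun u _ => ?_
      simp only [Finset.filter_insert, G.adj_comm v u]
      split_ifs
      · rw [Finset.card_insert_of_notMem (by simp [hv])]
      · rfl
    rw [this]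
    omega

lemma card_ge_of_two_le (h : IsQuad G V A f) {T : Finset α} (hT : T ⊆ V) (hTA : ∀ v ∈ T, v ∉ A)
    {d m : ℕ} (hd : ∀ v ∈ T, #{u ∈ T | G.Adj v u} ≤ d) (hm : f T = f ∅ + m) : 2 * m ≤ #T * d := by
  have h1 := h.two_mul_eq hT hTA
  have h2 := Finset.sum_le_card_nsmul T _ d hd
  rw [smul_eq_mul] at h2
  omega

lemma card_adj_lt {T : Finset α} {v : α} (hv : v ∈ T) : #{u ∈ T | G.Adj v u} ≤ #T - 1 := by
  rw [← Finset.card_erase_of_mem hv]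
  refine Finset.card_le_card fun u hu => ?_
  simp only [Finset.mem_filter] at hu
  exact Finset.mem_erase.2 ⟨hu.2.ne', hu.1⟩

/-- Two vertices span at most one edge. -/
lemma three_le_card (h : IsQuad G V A f) {T : Finset α} (hT : T ⊆ V) (hTA : ∀ v ∈ T, v ∉ A)
    {m : ℕ} (hm : 2 ≤ m) (hf : f T = f ∅ + m) : 3 ≤ #T := by
  have := h.card_ge_of_two_le hT hTA (fun v hv => card_adj_lt (G := G) hv) hf
  by_contra! hlt
  interval_cases #T <;> omega

lemma two_le_card (h : IsQuad G V A f) {T : Finset α} (hT : T ⊆ V) (hTA : ∀ v ∈ T, v ∉ A)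
    {m : ℕ} (hm : 1 ≤ m) (hf : f T = f ∅ + m) : 2 ≤ #T := by
  have := h.card_ge_of_two_le hT hTA (fun v hv => card_adj_lt (G := G) hv) hf
  by_contra! hlt
  interval_cases #T <;> omega

/-- Splitting off a vertex `v` that can be removed. -/
lemma cubeP_le_of_erase {v : α} (hv : v ∈ V) {P : Finset α → Prop} {c : ℝ}
    (h1 : cubeP (V.erase v) (fun S => P (Insert.insert v S)) ≤ c)
    (h0 : cubeP (V.erase v) P ≤ c) : cubeP V P ≤ c := by
  rw [← Finset.insert_erase hv, cubeP_insert (Finset.notMem_erase _ _)]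
  linarith

/-- The scheme of `cubeP_le` with threshold two instead of five; `4 / 9` is the largest binomial
weight for two variables. -/
theorem cubeP_le_four_ninths (h : IsQuad G V A f) {m : ℕ} (hm : 1 ≤ m) :
    cubeP V (fun S => f S = f ∅ + m) ≤ 4 / 9 := by
  induction V using Finset.strongInduction generalizing A f with
  | H V ih =>
  by_cases h2 : 2 ≤ #A
  · have := h.cubeP_le_of_active (X := ∅) (Finset.empty_subset _) subset_rfl
      (Finset.disjoint_empty_left _) h.subset (fun v hv => Or.inl hv)
      (binomWeight_le_of_two_le h2) (f ∅ + m)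
    simpa using this
  by_cases hlink : ∃ v ∈ V, v ∉ A ∧ ∀ u ∈ A, ¬ G.Adj v u
  · obtain ⟨v, hv, hvA, hadj⟩ := hlink
    have hss := Finset.erase_ssubset hv
    refine cubeP_le_of_erase hv ?_ (ih _ hss (h.restrict hss.subset))
    have := ih _ hss (h.link hss.subset hv (Finset.notMem_erase _ _) fun u _ hu => hadj u hu)
    simpa [h.apply_singleton hv, hvA] using this
  push Not at hlink
  rcases Finset.eq_empty_or_nonempty A with rfl | ⟨w, hw⟩
  · have hV : V = ∅ := by
      refine Finset.eq_empty_of_forall_notMem fun v hv => ?_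
      simpa using hlink v hv (Finset.notMem_empty _)
    rw [cubeP_eq_zero]
    · norm_num
    · intro S hS
      rw [hV, Finset.subset_empty] at hS
      subst hS
      omega
  have hA : A = {w} :=
    Finset.eq_singleton_iff_unique_mem.2 ⟨hw, fun u hu => Finset.card_le_one.1 (by omega) u hu w hw⟩
  have hwV := h.subset hw
  have hss := Finset.erase_ssubset hwV
  -- Every other vertex is now adjacent to `w`, hence active once `w` is present. If there is at
  -- most one, no edge avoids `w`, so the event forces `w` and has probability at most `1 / 3`.
  by_cases hB : 2 ≤ #(V.erase w)
  · refine cubeP_le_of_erase hwV ?_ (ih _ hss (h.restrict hss.subset))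
    have := h.cubeP_le_of_active (X := {w}) (W := V.erase w) (by simpa using hwV) hss.subset
      (by simp) subset_rfl (fun v hv => ?_) (binomWeight_le_of_two_le hB) (f ∅ + m)
    · simpa [← Finset.insert_eq] using this
    · obtain ⟨hvw, hv⟩ := Finset.mem_erase.1 hv
      obtain ⟨u, hu, hvu⟩ := hlink v hv (by simp [hA, hvw])
      exact Or.inr ⟨u, by rwa [← hA], hvu⟩
  · rw [← Finset.insert_erase hwV, cubeP_insert (Finset.notMem_erase _ _)]
    have h0 : cubeP (V.erase w) (fun S => f S = f ∅ + m) = 0 := by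
      refine cubeP_eq_zero fun S hS hf => hB ?_
      refine (h.two_le_card (hS.trans hss.subset) (fun v hv => ?_) hm hf).trans
        (Finset.card_le_card hS)
      rw [hA]
      simpa using (Finset.mem_erase.1 (hS hv)).1
    linarith [cubeP_le_one (V.erase w) fun S => f (Insert.insert w S) = f ∅ + m]

end IsQuad

end Quad

/-! ### The bound 80/243 -/

section Quad

variable {α : Type*} [DecidableEq α] {G : SimpleGraph α} [DecidableRel G.Adj]

lemma cubeP_mem_eq {V : Finset α} {v : α} (hv : v ∈ V) : cubeP V (v ∈ ·) = 1 / 3 := by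
  rw [← Finset.insert_erase hv, cubeP_insert (Finset.notMem_erase _ _),
    cubeP_eq_zero (P := (v ∈ ·)) fun S hS h => Finset.notMem_erase v V (hS h)]
  simp [cubeP, cubeE_const]

lemma cubeP_le_card_eq (V : Finset α) (k : ℕ) :
    cubeP V (fun S => k ≤ #S) =
      ∑ j ∈ Finset.range (#V + 1), binomWeight #V j * if k ≤ j then 1 else 0 := by
  rw [← cubeE_card]
  simp only [cubeP]
  congr!

namespace IsQuad

variable {V A : Finset α} {f : Finset α → ℕ}

/-- Average the refined antichain bound on `A` over the trace of the random set on `V \ A`. -/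
lemma cubeP_le_linear (h : IsQuad G V A f) {c : ℝ} (hc : 0 ≤ c)
    (hcb : ∀ k, 2 ≤ k → binomWeight #A k ≤ c) (L : ℕ) :
    cubeP V (fun S => f S = L) ≤ c + (binomWeight #A 0 - c) * cubeP (V \ A) (fun T => f T = L) +
      (binomWeight #A 1 - c) / #A *
        ∑ i ∈ A, cubeP (V \ A) (fun T => f (Insert.insert i T) = L) := by
  classical
  have hd : Disjoint A (V \ A) := Finset.disjoint_sdiff
  have hV : cubeP V (fun S => f S = L) =
      cubeE (V \ A) fun T => cubeP A fun R => f (T ∪ R) = L := by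
    rw [← cubeP_union hd fun S => f S = L, Finset.union_sdiff_of_subset h.subset]
  rw [hV]
  have key : ∀ T ⊆ V \ A, cubeP A (fun R => f (T ∪ R) = L) ≤
      c + (binomWeight #A 0 - c) * (if f T = L then 1 else 0) + (binomWeight #A 1 - c) / #A *
        ∑ i ∈ A, if f (Insert.insert i T) = L then 1 else 0 := by
    intro T hT
    have := cubeP_le_of_isAntichain_of_small
      (h.isAntichain (hT.trans Finset.sdiff_subset) h.subset
        (Finset.disjoint_of_subset_right hT hd).symm (fun v hv => Or.inl hv) L) hc hcb
    simpa [Finset.union_comm T, ← Finset.insert_eq] using this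
  refine (cubeE_mono key).trans (le_of_eq ?_)
  rw [cubeE_add, cubeE_add, cubeE_const, cubeE_const_mul, cubeE_const_mul, cubeE_sum]
  simp only [cubeP]
  congr!

/-- The vertex `i` already contributes 1, leaving a target `m - 1 ≥ 1` for its link. -/
lemma cubeP_insert_le (h : IsQuad G V A f) {m : ℕ} (hm : 2 ≤ m) {i : α} (hi : i ∈ A) :
    cubeP (V \ A) (fun T => f (Insert.insert i T) = f ∅ + m) ≤ 4 / 9 := by
  have hq := h.link (W := V \ A) Finset.sdiff_subset (h.subset hi) (by simp [hi])
    (fun u hu huA => absurd huA (Finset.mem_sdiff.1 hu).2)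
  have := hq.cubeP_le_four_ninths (m := m - 1) (by omega)
  simp only [insert_empty_eq, h.apply_singleton (h.subset hi), hi, if_true] at this
  rwa [show f ∅ + 1 + (m - 1) = f ∅ + m by omega] at this

/-! ### Irreducible configurations, by number of linear terms -/

section Reduced

variable (h : IsQuad G V A f)
  (hdeg : ∀ v ∈ V, #{u ∈ V.erase v | u ∈ A ∨ G.Adj v u} ≤ 4)
  (hadj : ∀ v ∈ V, v ∉ A → ∃ u ∈ A, G.Adj v u)

include h hdeg

lemma card_adj_of_mem {i : α} (hi : i ∈ A) : #{u ∈ V \ A | G.Adj i u} + #A ≤ 5 := by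
  have hd : Disjoint {u ∈ V \ A | G.Adj i u} (A.erase i) := by
    refine Finset.disjoint_left.2 fun u hu hu' => ?_
    simp only [Finset.mem_filter, Finset.mem_sdiff] at hu
    exact hu.1.2 (Finset.mem_erase.1 hu').2
  have hsub : {u ∈ V \ A | G.Adj i u} ∪ A.erase i ⊆ {u ∈ V.erase i | u ∈ A ∨ G.Adj i u} := by
    intro u hu
    simp only [Finset.mem_union, Finset.mem_filter, Finset.mem_sdiff, Finset.mem_erase] at hu ⊢
    rcases hu with ⟨⟨h1, h2⟩, h3⟩ | ⟨h1, h2⟩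
    · exact ⟨⟨h3.ne', h1⟩, Or.inr h3⟩
    · exact ⟨⟨h1, h.subset h2⟩, Or.inl h2⟩
  have := (Finset.card_le_card hsub).trans (hdeg i (h.subset hi))
  rw [Finset.card_union_of_disjoint hd, Finset.card_erase_of_mem hi] at this
  have := Finset.card_pos.2 ⟨i, hi⟩
  omega

lemma card_adj_of_notMem {v : α} (hv : v ∈ V \ A) : #{u ∈ V \ A | G.Adj v u} + #A ≤ 4 := by
  have hd : Disjoint {u ∈ V \ A | G.Adj v u} A := by
    refine Finset.disjoint_left.2 fun u hu hu' => ?_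
    simp only [Finset.mem_filter, Finset.mem_sdiff] at hu
    exact hu.1.2 hu'
  have hv' := Finset.mem_sdiff.1 hv
  have hsub : {u ∈ V \ A | G.Adj v u} ∪ A ⊆ {u ∈ V.erase v | u ∈ A ∨ G.Adj v u} := by
    intro u hu
    simp only [Finset.mem_union, Finset.mem_filter, Finset.mem_sdiff, Finset.mem_erase] at hu ⊢
    rcases hu with ⟨⟨h1, h2⟩, h3⟩ | h2
    · exact ⟨⟨h3.ne', h1⟩, Or.inr h3⟩
    · exact ⟨⟨fun e => hv'.2 (e ▸ h2), h.subset h2⟩, Or.inl h2⟩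
  rw [← Finset.card_union_of_disjoint hd]
  exact (Finset.card_le_card hsub).trans (hdeg v hv'.1)

lemma card_adj_subset {T : Finset α} (hT : T ⊆ V \ A) {v : α} (hv : v ∈ T) :
    #{u ∈ T | G.Adj v u} ≤ 4 - #A := by
  have h1 := h.card_adj_of_notMem hdeg (hT hv)
  have h2 : #{u ∈ T | G.Adj v u} ≤ #{u ∈ V \ A | G.Adj v u} :=
    Finset.card_le_card (Finset.filter_subset_filter _ hT)
  omega

include hadj

/-- The neighbourhoods of the elements of `A` cover `V \ A`, and each has at most `5 - #A` elements
there. -/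
lemma card_sdiff_le : #(V \ A) ≤ #A * (5 - #A) := by
  have hsub : V \ A ⊆ A.biUnion fun i => {u ∈ V \ A | G.Adj i u} := by
    intro v hv
    obtain ⟨h1, h2⟩ := Finset.mem_sdiff.1 hv
    obtain ⟨u, hu, hvu⟩ := hadj v h1 h2
    exact Finset.mem_biUnion.2 ⟨u, hu, by simp [h1, h2, hvu.symm]⟩
  refine (Finset.card_le_card hsub).trans (Finset.card_biUnion_le_card_mul _ _ _ fun i hi => ?_)
  have := h.card_adj_of_mem hdeg hi
  omega

omit hadj

lemma cubeP_le_of_card_eq_four (hA : #A = 4) {m : ℕ} (hm : 2 ≤ m) :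
    cubeP V (fun S => f S = f ∅ + m) ≤ 80 / 243 := by
  -- The largest weight for `n = 4` beyond `k = 1`. The correction at `∅` is negative; the
  -- singletons cost `8 / 81` times `1 / 3`, for a total of exactly `80 / 243`.
  have hlin := h.cubeP_le_linear (c := 24 / 81) (by norm_num) (fun k hk => ?_) (f ∅ + m)
  swap
  · rw [hA]
    rcases le_or_gt k 4 with h4 | h4
    · interval_cases k <;> norm_num [binomWeight, Nat.choose]
    · rw [binomWeight_eq_zero h4]
      norm_num
  -- `V \ A` spans no edge and contains at most one neighbour of `i`, which must be present to reach
  -- `m ≥ 2`.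
  have hi : ∀ i ∈ A, cubeP (V \ A) (fun T => f (Insert.insert i T) = f ∅ + m) ≤ 1 / 3 := by
    intro i hi
    have hN := h.card_adj_of_mem hdeg hi
    have hex : ∀ T ⊆ V \ A, f (Insert.insert i T) = f ∅ + m → ∃ u ∈ T, G.Adj i u := by
      intro T hT hf
      have hTV := hT.trans Finset.sdiff_subset
      rw [h.insert T hTV i (h.subset hi) fun e => (Finset.mem_sdiff.1 (hT e)).2 hi, if_pos hi] at hf
      have hmono := h.mono (Finset.empty_subset T) hTV
      have h0 := h.card_ge_of_two_le (m := f T - f ∅) hTV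
        (fun v hv => (Finset.mem_sdiff.1 (hT hv)).2)
        (fun v hv => h.card_adj_subset hdeg hT hv) (by omega)
      rw [hA] at h0
      obtain ⟨u, hu⟩ := Finset.card_pos.1 (show 0 < #{u ∈ T | G.Adj i u} by omega)
      exact ⟨u, (Finset.mem_filter.1 hu).1, (Finset.mem_filter.1 hu).2⟩
    rcases Finset.eq_empty_or_nonempty {u ∈ V \ A | G.Adj i u} with he | ⟨w, hw⟩
    · rw [cubeP_eq_zero]
      · norm_num
      · intro T hT hf
        obtain ⟨u, hu, hiu⟩ := hex T hT hf
        exact Finset.notMem_empty u (he ▸ Finset.mem_filter.2 ⟨hT hu, hiu⟩)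
    · rw [← cubeP_mem_eq (Finset.mem_filter.1 hw).1]
      refine cubeP_mono fun T hT hf => ?_
      obtain ⟨u, hu, hiu⟩ := hex T hT hf
      rwa [Finset.card_le_one.1 (by omega : #{u ∈ V \ A | G.Adj i u} ≤ 1) w hw u
        (Finset.mem_filter.2 ⟨hT hu, hiu⟩)]
  have hsum := Finset.sum_le_card_nsmul A _ _ hi
  have h0 := cubeP_nonneg (V \ A) fun T => f T = f ∅ + m
  rw [hA] at hlin hsum
  norm_num [binomWeight] at hlin hsum
  linarith

include hadj

lemma cubeP_le_of_card_eq_three (hA : #A = 3) {m : ℕ} (hm : 2 ≤ m) :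
    cubeP V (fun S => f S = f ∅ + m) ≤ 80 / 243 := by
  have hlin := h.cubeP_le_linear (c := 6 / 27) (by norm_num) (fun k hk => ?_) (f ∅ + m)
  swap
  · rw [hA]
    rcases le_or_gt k 3 with h4 | h4
    · interval_cases k <;> norm_num [binomWeight, Nat.choose]
    · rw [binomWeight_eq_zero h4]
      norm_num
  have hsum := Finset.sum_le_card_nsmul A _ _ fun i hi => h.cubeP_insert_le hm hi
  have hB := h.card_sdiff_le hdeg hadj
  -- Degrees inside `V \ A` are at most 1, so two edges need four vertices out of at most six.
  have h0 : cubeP (V \ A) (fun T => f T = f ∅ + m) ≤ 1 / 9 := by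
    refine (cubeP_mono (Q := fun T => 4 ≤ #T) fun T hT hf => ?_).trans ?_
    · have := h.card_ge_of_two_le (hT.trans Finset.sdiff_subset)
        (fun v hv => (Finset.mem_sdiff.1 (hT hv)).2)
        (fun v hv => h.card_adj_subset hdeg hT hv) hf
      rw [hA] at this
      omega
    · rw [cubeP_le_card_eq]
      rw [hA] at hB
      generalize #(V \ A) = n at hB ⊢
      interval_cases n <;> norm_num [Finset.sum_range_succ, binomWeight, Nat.choose]
  rw [hA] at hlin hsum
  norm_num [binomWeight] at hlin hsum
  linarith

omit hadj in
lemma cubeP_sdiff_le_of_card_eq_six (hA : #A = 2) (hB : #(V \ A) = 6) {m : ℕ} (hm : 2 ≤ m) :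
    cubeP (V \ A) (fun T => f T = f ∅ + m) ≤ 121 / 729 := by
  -- A triple with two edges is a centre with its whole neighbourhood in `V \ A`, as degrees there
  -- are at most 2. Six centres give at most six triples, each of weight `8 / 729`.
  let F : Finset (Finset α) :=
    {T ∈ (V \ A).image fun c => Insert.insert c {u ∈ V \ A | G.Adj c u} | #T = 3}
  have hF : #F ≤ 6 := (Finset.card_filter_le _ _).trans (Finset.card_image_le.trans hB.le)
  have hF3 : cubeP (V \ A) (· ∈ F) ≤ 48 / 729 := by
    refine (cubeP_mem_le F 3 fun S hS => (Finset.mem_filter.1 hS).2).trans ?_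
    have : (#F : ℝ) ≤ 6 := by exact_mod_cast hF
    rw [hB]
    norm_num
    linarith
  have h4 : cubeP (V \ A) (fun T => 4 ≤ #T) ≤ 73 / 729 := by
    rw [cubeP_le_card_eq, hB]
    norm_num [Finset.sum_range_succ, binomWeight, Nat.choose]
  have hor : cubeP (V \ A) (fun T => f T = f ∅ + m) ≤
      cubeP (V \ A) (fun T => 4 ≤ #T ∨ T ∈ F) := by
    refine cubeP_mono fun T hT hf => ?_
    have hTV := hT.trans Finset.sdiff_subset
    have hTA : ∀ v ∈ T, v ∉ A := fun v hv => (Finset.mem_sdiff.1 (hT hv)).2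
    have h3 := h.three_le_card hTV hTA hm hf
    rcases eq_or_lt_of_le h3 with h3 | h3
    swap
    · exact Or.inl h3
    right
    obtain ⟨c, hc, hc2⟩ : ∃ c ∈ T, 2 ≤ #{u ∈ T | G.Adj c u} := by
      by_contra! hlt
      have := h.card_ge_of_two_le hTV hTA (fun v hv => Nat.le_of_lt_succ (hlt v hv)) hf
      omega
    have hle := h.card_adj_of_notMem hdeg (hT hc)
    have hN : ({u ∈ T | G.Adj c u} : Finset α) = {u ∈ V \ A | G.Adj c u} :=
      Finset.eq_of_subset_of_card_le (Finset.filter_subset_filter _ hT) (by omega)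
    have hT' : Insert.insert c ({u ∈ T | G.Adj c u} : Finset α) = T := by
      refine Finset.eq_of_subset_of_card_le
        (Finset.insert_subset hc (Finset.filter_subset _ _)) ?_
      rw [Finset.card_insert_of_notMem (by simp)]
      omega
    refine Finset.mem_filter.2 ⟨Finset.mem_image.2 ⟨c, hT hc, ?_⟩, h3.symm⟩
    rw [← hN, hT']
  have := cubeP_or_le (V \ A) (fun T => 4 ≤ #T) (· ∈ F)
  linarith

lemma cubeP_le_of_card_eq_two (hA : #A = 2) {m : ℕ} (hm : 2 ≤ m) :
    cubeP V (fun S => f S = f ∅ + m) ≤ 80 / 243 := by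
  have hB := h.card_sdiff_le hdeg hadj
  rw [hA] at hB
  obtain ⟨i, j, hij, hAij⟩ := Finset.card_eq_two.1 hA
  have hi : i ∈ A := by simp [hAij]
  have hj : j ∈ A := by simp [hAij]
  have hV : V = Insert.insert i (Insert.insert j (V \ A)) := by
    conv_lhs => rw [← Finset.union_sdiff_of_subset h.subset]
    rw [hAij, Finset.insert_union, Finset.singleton_union]
  have hsplit : cubeP V (fun S => f S = f ∅ + m) =
      1 / 3 * (1 / 3 * cubeP (V \ A) (fun T => f ({i, j} ∪ T) = f ∅ + m) +
        2 / 3 * cubeP (V \ A) (fun T => f (Insert.insert i T) = f ∅ + m)) +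
      2 / 3 * (1 / 3 * cubeP (V \ A) (fun T => f (Insert.insert j T) = f ∅ + m) +
        2 / 3 * cubeP (V \ A) (fun T => f T = f ∅ + m)) := by
    conv_lhs => rw [hV]
    rw [cubeP_insert (by simp [hij, hi]), cubeP_insert (by simp [hj]),
      cubeP_insert (by simp [hj])]
    simp only [Finset.insert_union, Finset.singleton_union]
  have h1 := h.cubeP_insert_le hm hi
  have h2 := h.cubeP_insert_le hm hj
  have h12 : ∀ c : ℝ, (∀ k, binomWeight #(V \ A) k ≤ c) →
      cubeP (V \ A) (fun T => f ({i, j} ∪ T) = f ∅ + m) ≤ c := by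
    intro c hc
    refine h.cubeP_le_of_active (by rw [← hAij]; exact h.subset) Finset.sdiff_subset
      (by rw [← hAij]; exact Finset.disjoint_sdiff) subset_rfl (fun v hv => Or.inr ?_) hc _
    obtain ⟨hv1, hv2⟩ := Finset.mem_sdiff.1 hv
    rw [← hAij]
    exact hadj v hv1 hv2
  have h3 : cubeP (V \ A) (fun T => f T = f ∅ + m) ≤ cubeP (V \ A) (fun T => 3 ≤ #T) :=
    cubeP_mono fun T hT hf => h.three_le_card (hT.trans Finset.sdiff_subset)
      (fun v hv => (Finset.mem_sdiff.1 (hT hv)).2) hm hf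
  rw [cubeP_le_card_eq] at h3
  have h6 := h.cubeP_sdiff_le_of_card_eq_six hdeg hA (hm := hm)
  have hone := cubeP_le_one (V \ A) (fun T => f ({i, j} ∪ T) = f ∅ + m)
  have h45 : 2 ≤ #(V \ A) → _ := fun hn => h12 _ (binomWeight_le_of_two_le hn)
  have h80 : 5 ≤ #(V \ A) → _ := fun hn => h12 _ (binomWeight_le_of_five_le hn)
  clear h12
  rw [hsplit]
  generalize cubeP (V \ A) (fun T => f ({i, j} ∪ T) = f ∅ + m) = x at hone h45 h80 ⊢
  generalize #(V \ A) = n at hB h3 h6 h45 h80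
  -- The tightest case is `n = 5`, with `716 / 2187` against `720 / 2187`. For `n = 6` the estimate
  -- by `3 ≤ #T` is too weak, hence `h6`.
  interval_cases n <;> norm_num [Finset.sum_range_succ, binomWeight, Nat.choose] at h3 h6 h45 h80 <;>
    linarith

lemma cubeP_le_of_card_eq_one (hA : #A = 1) {m : ℕ} (hm : 2 ≤ m) :
    cubeP V (fun S => f S = f ∅ + m) ≤ 80 / 243 := by
  have hB := h.card_sdiff_le hdeg hadj
  rw [hA] at hB
  obtain ⟨i, hAi⟩ := Finset.card_eq_one.1 hA
  have hi : i ∈ A := by simp [hAi]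
  have hV : V = Insert.insert i (V \ A) := by
    conv_lhs => rw [← Finset.union_sdiff_of_subset h.subset]
    rw [hAi, Finset.singleton_union]
  have hsplit : cubeP V (fun S => f S = f ∅ + m) =
      1 / 3 * cubeP (V \ A) (fun T => f (Insert.insert i T) = f ∅ + m) +
      2 / 3 * cubeP (V \ A) (fun T => f T = f ∅ + m) := by
    conv_lhs => rw [hV]
    rw [cubeP_insert (by simp [hi])]
  have h1 := h.cubeP_insert_le hm hi
  have h3 : cubeP (V \ A) (fun T => f T = f ∅ + m) ≤ 1 / 9 := by
    refine (cubeP_mono (Q := fun T => 3 ≤ #T) fun T hT hf =>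
      h.three_le_card (hT.trans Finset.sdiff_subset)
        (fun v hv => (Finset.mem_sdiff.1 (hT hv)).2) hm hf).trans ?_
    rw [cubeP_le_card_eq]
    generalize #(V \ A) = n at hB ⊢
    interval_cases n <;> norm_num [Finset.sum_range_succ, binomWeight, Nat.choose]
  rw [hsplit]
  linarith

end Reduced

theorem cubeP_le (h : IsQuad G V A f) {m : ℕ} (hm : 2 ≤ m) :
    cubeP V (fun S => f S = f ∅ + m) ≤ 80 / 243 := by
  induction V using Finset.strongInduction generalizing A f with
  | H V ih =>
  by_cases h5 : 5 ≤ #A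
  · have := h.cubeP_le_of_active (X := ∅) (Finset.empty_subset _) subset_rfl
      (Finset.disjoint_empty_left _) h.subset (fun v hv => Or.inl hv)
      (binomWeight_le_of_five_le h5) (f ∅ + m)
    simpa using this
  -- Since `v` has no neighbour in `A`, fixing it present gives no variable coefficient 2, and `f
  -- {v} = f ∅` keeps the target.
  by_cases hlink : ∃ v ∈ V, v ∉ A ∧ ∀ u ∈ A, ¬ G.Adj v u
  · obtain ⟨v, hv, hvA, hadj⟩ := hlink
    have hss := Finset.erase_ssubset hv
    refine cubeP_le_of_erase hv ?_ (ih _ hss (h.restrict hss.subset))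
    have := ih _ hss (h.link hss.subset hv (Finset.notMem_erase _ _) fun u _ hu => hadj u hu)
    simpa [h.apply_singleton hv, hvA] using this
  by_cases hdeg : ∃ v ∈ V, 5 ≤ #{u ∈ V.erase v | u ∈ A ∨ G.Adj v u}
  · obtain ⟨v, hv, hcard⟩ := hdeg
    have hss := Finset.erase_ssubset hv
    refine cubeP_le_of_erase hv ?_ (ih _ hss (h.restrict hss.subset))
    have := h.cubeP_le_of_active (X := {v}) (by simpa using hv) hss.subset (by simp)
      (Finset.filter_subset _ _) (fun u hu => ?_) (binomWeight_le_of_five_le hcard) (f ∅ + m)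
    · simpa [← Finset.insert_eq] using this
    · rcases (Finset.mem_filter.1 hu).2 with hu | hu
      · exact Or.inl hu
      · exact Or.inr ⟨v, Finset.mem_singleton_self v, hu.symm⟩
  push Not at hlink hdeg
  have hdeg : ∀ v ∈ V, #{u ∈ V.erase v | u ∈ A ∨ G.Adj v u} ≤ 4 :=
    fun v hv => Nat.le_of_lt_succ (hdeg v hv)
  obtain hA | hA | hA | hA | hA : #A = 0 ∨ #A = 1 ∨ #A = 2 ∨ #A = 3 ∨ #A = 4 := by omega
  · obtain rfl := Finset.card_eq_zero.1 hA
    rw [cubeP_eq_zero]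
    · norm_num
    · intro S hS hf
      have hS' : S = ∅ := by
        refine Finset.eq_empty_of_forall_notMem fun v hv => ?_
        simpa using hlink v (hS hv) (Finset.notMem_empty _)
      subst hS'
      omega
  · exact h.cubeP_le_of_card_eq_one hdeg hlink hA hm
  · exact h.cubeP_le_of_card_eq_two hdeg hlink hA hm
  · exact h.cubeP_le_of_card_eq_three hdeg hlink hA hm
  · exact h.cubeP_le_of_card_eq_four hdeg hA hm

end IsQuad

end Quad

/-! ### From polynomials and Bernoulli vectors to random subsets -/

section Transfer

/-- The linear terms of a polynomial. -/
noncomputable def linearPart {s : ℕ} (f : MvPolynomial (Fin s) ℝ) : Finset (Fin s) :=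
  {i | Finsupp.single i 1 ∈ f.support}

/-- The graph whose edges are the products of two distinct variables that occur in a polynomial. -/
def productGraph {s : ℕ} (f : MvPolynomial (Fin s) ℝ) : SimpleGraph (Fin s) where
  Adj u v := u ≠ v ∧ Finsupp.single u 1 + Finsupp.single v 1 ∈ f.support
  symm := ⟨fun u v h => ⟨h.1.symm, by rw [add_comm]; exact h.2⟩⟩
  loopless := ⟨fun _ h => h.1 rfl⟩

/-- The number of monomials of a polynomial all of whose variables lie in `S`. -/
def monomialCount {s : ℕ} (f : MvPolynomial (Fin s) ℝ) (S : Finset (Fin s)) : ℕ :=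
  #{d ∈ f.support | d.support ⊆ S}

lemma monomialCount_empty {s : ℕ} {f : MvPolynomial (Fin s) ℝ} (hf : f ∈ quadPolys s) :
    monomialCount f ∅ = 0 := by
  rw [monomialCount, Finset.card_eq_zero, Finset.filter_eq_empty_iff]
  intro d hd h
  rw [Finset.subset_empty, Finsupp.support_eq_empty] at h
  subst h
  exact MvPolynomial.mem_support_iff.1 hd hf.2.2.2

lemma eq_single_or_of_mem_support {s : ℕ} {f : MvPolynomial (Fin s) ℝ} (hf : f ∈ quadPolys s)
    {d : Fin s →₀ ℕ} (hd : d ∈ f.support) {v : Fin s} (hv : v ∈ d.support) :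
    d = Finsupp.single v 1 ∨ ∃ u, u ≠ v ∧ d = Finsupp.single v 1 + Finsupp.single u 1 := by
  have hdeg : d.degree ≤ 2 := (MvPolynomial.le_totalDegree hd).trans hf.1
  have hle : d v ≤ 1 := (MvPolynomial.degreeOf_le_iff.1 (hf.2.1 v)) d hd
  have hv1 : 1 ≤ d v := Nat.one_le_iff_ne_zero.2 (Finsupp.mem_support_iff.1 hv)
  obtain ⟨e, rfl⟩ : ∃ e, d = Finsupp.single v 1 + e :=
    exists_add_of_le (Finsupp.single_le_iff.2 hv1)
  rw [map_add, Finsupp.degree_single] at hdeg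
  rcases Nat.eq_zero_or_pos e.degree with h0 | h0
  · left
    rw [Finsupp.degree_eq_zero_iff] at h0
    simp [h0]
  · right
    obtain ⟨u, hu⟩ : ∃ u, e u ≠ 0 := by
      by_contra! h
      rw [show e = 0 from Finsupp.ext h] at h0
      simp at h0
    obtain ⟨e', rfl⟩ : ∃ e', e = Finsupp.single u 1 + e' :=
      exists_add_of_le (Finsupp.single_le_iff.2 (Nat.one_le_iff_ne_zero.2 hu))
    rw [map_add, Finsupp.degree_single] at hdeg
    obtain rfl : e' = 0 := (Finsupp.degree_eq_zero_iff e').1 (by omega)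
    rw [add_zero] at hle ⊢
    refine ⟨u, ?_, rfl⟩
    rintro rfl
    simp at hle

open Classical in
lemma isQuad_monomialCount {s : ℕ} {f : MvPolynomial (Fin s) ℝ} (hf : f ∈ quadPolys s) :
    IsQuad (productGraph f) Finset.univ (linearPart f) (monomialCount f) where
  subset := Finset.subset_univ _
  insert S _ v _ hvS := by
    -- The monomials gained by adding `v` are `v` itself, if present in `f`, and the products of `v`
    -- with its neighbours in `S`.
    have hsplit : ({d ∈ f.support | d.support ⊆ insert v S} : Finset (Fin s →₀ ℕ)) =
        ({d ∈ f.support | d.support ⊆ S} ∪ (if v ∈ linearPart f then {Finsupp.single v 1} else ∅)) ∪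
          ({u ∈ S | (productGraph f).Adj v u} : Finset (Fin s)).image
            fun u => Finsupp.single v 1 + Finsupp.single u 1 := by
      ext d
      simp only [Finset.mem_filter, Finset.mem_union, Finset.mem_image]
      constructor
      · rintro ⟨hd, hdS⟩
        by_cases hv : v ∈ d.support
        · rcases eq_single_or_of_mem_support hf hd hv with rfl | ⟨u, huv, rfl⟩
          · left
            right
            rw [if_pos (by simpa [linearPart] using hd)]
            simp
          · right
            refine ⟨u, ⟨?_, huv.symm, hd⟩, rfl⟩
            have : u ∈ insert v S := hdS (by simp)
            exact (Finset.mem_insert.1 this).resolve_left huv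
        · exact Or.inl (Or.inl ⟨hd, (Finset.subset_insert_iff_of_notMem hv).1 hdS⟩)
      · rintro ((⟨hd, hdS⟩ | hd) | ⟨u, ⟨huS, -, hd⟩, rfl⟩)
        · exact ⟨hd, hdS.trans (Finset.subset_insert _ _)⟩
        · split_ifs at hd with h
          · rw [Finset.mem_singleton.1 hd]
            refine ⟨by simpa [linearPart] using h, ?_⟩
            exact Finsupp.support_single_subset.trans (by simp)
          · simp at hd
        · refine ⟨hd, Finsupp.support_add.trans (Finset.union_subset ?_ ?_)⟩
          · exact Finsupp.support_single_subset.trans (by simp)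
          · exact Finsupp.support_single_subset.trans (by simp [huS])
    have hinj : Function.Injective
        fun u : Fin s => (Finsupp.single v 1 + Finsupp.single u 1 : Fin s →₀ ℕ) := by
      intro u w huw
      exact Finsupp.single_left_injective one_ne_zero (add_left_cancel huw)
    have hd1 : Disjoint ({d ∈ f.support | d.support ⊆ S} : Finset (Fin s →₀ ℕ))
        (if v ∈ linearPart f then {Finsupp.single v 1} else ∅) := by
      split_ifs
      · rw [Finset.disjoint_singleton_right, Finset.mem_filter]
        rintro ⟨-, h⟩
        exact hvS (h (by simp))
      · exact Finset.disjoint_empty_right _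
    have hd2 : Disjoint (({d ∈ f.support | d.support ⊆ S} : Finset (Fin s →₀ ℕ)) ∪
          (if v ∈ linearPart f then {Finsupp.single v 1} else ∅))
        (({u ∈ S | (productGraph f).Adj v u} : Finset (Fin s)).image
          fun u => Finsupp.single v 1 + Finsupp.single u 1) := by
      rw [Finset.disjoint_right]
      intro d hd hd'
      obtain ⟨u, hu, rfl⟩ := Finset.mem_image.1 hd
      rcases Finset.mem_union.1 hd' with h | h
      · exact hvS ((Finset.mem_filter.1 h).2 (by simp))
      · split_ifs at h
        · simpa using Finset.mem_singleton.1 h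
        · simp at h
    rw [monomialCount, hsplit, Finset.card_union_of_disjoint hd2, Finset.card_union_of_disjoint hd1,
      Finset.card_image_of_injective _ hinj, monomialCount]
    split_ifs <;> simp

lemma eval_indicator {s : ℕ} {f : MvPolynomial (Fin s) ℝ} (hf : f ∈ quadPolys s)
    (S : Finset (Fin s)) :
    MvPolynomial.eval (fun i => if i ∈ S then (1 : ℝ) else 0) f = monomialCount f S := by
  rw [MvPolynomial.eval_eq, monomialCount, Finset.card_filter]
  push_cast
  refine Finset.sum_congr rfl fun d hd => ?_
  rw [(hf.2.2.1 d).resolve_left (MvPolynomial.mem_support_iff.1 hd), one_mul]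
  split_ifs with h
  · refine Finset.prod_eq_one fun i hi => ?_
    rw [if_pos (h hi), one_pow]
  · obtain ⟨i, hi, hiS⟩ := Finset.not_subset.1 h
    refine Finset.prod_eq_zero hi ?_
    rw [if_neg hiS, zero_pow (Finsupp.mem_support_iff.1 hi)]

instance {s : ℕ} {p : unitInterval} : IsProbabilityMeasure (bernoulliVector s p) := by
  unfold bernoulliVector
  infer_instance

lemma bernoulliVector_real_singleton {s : ℕ} {p : unitInterval} (hp : (p : ℝ) = 1 / 3)
    (S : Finset (Fin s)) :
    (bernoulliVector s p).real {fun i => if i ∈ S then (1 : ℝ) else 0} =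
      (1 / 3) ^ #S * (2 / 3) ^ (s - #S) := by
  classical
  rw [bernoulliVector, measureReal_def, Measure.pi_singleton, ENNReal.toReal_prod]
  have : ∀ i, (bernoulliMeasure (1 : ℝ) 0 p {if i ∈ S then (1 : ℝ) else 0}).toReal =
      if i ∈ S then 1 / 3 else 2 / 3 := by
    intro i
    rw [← measureReal_def, bernoulliMeasure_real_apply p (measurableSet_singleton _)]
    by_cases h : i ∈ S
    · simp [h, hp]
    · simp [h, hp]
      norm_num
  simp only [this]
  rw [Finset.prod_ite, Finset.prod_const, Finset.prod_const, Finset.filter_not,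
    Finset.card_sdiff_of_subset (Finset.filter_subset _ _)]
  simp

/-- A Bernoulli vector with parameter `1 / 3` is the indicator vector of a random subset. -/
lemma bernoulliVector_real_eq_cubeP {s : ℕ} {p : unitInterval} (hp : (p : ℝ) = 1 / 3)
    (X : Set (Fin s → ℝ)) :
    (bernoulliVector s p).real X =
      cubeP Finset.univ fun S : Finset (Fin s) => (fun i => if i ∈ S then (1 : ℝ) else 0) ∈ X := by
  classical
  let e : Finset (Fin s) → Fin s → ℝ := fun S i => if i ∈ S then 1 else 0
  have he : Function.Injective e := by
    intro S T hST
    ext i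
    have := congrFun hST i
    simp only [e] at this
    by_cases h1 : i ∈ S <;> by_cases h2 : i ∈ T <;> simp_all
  have hfin : ∀ P : Finset (Fin s) → Prop,
      (bernoulliVector s p).real ((Finset.univ.filter P).image e : Finset (Fin s → ℝ)) =
        cubeP Finset.univ P := by
    intro P
    rw [← sum_measureReal_singleton, Finset.sum_image he.injOn, cubeP_eq_sum_filter,
      Finset.powerset_univ]
    refine Finset.sum_congr (by congr) fun S _ => ?_
    rw [Finset.card_univ, Fintype.card_fin]
    exact bernoulliVector_real_singleton hp S
  -- The indicator vectors carry full mass because their weights sum to 1.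
  have hnull : bernoulliVector s p (Set.range e)ᶜ = 0 := by
    have hone := hfin fun _ => True
    rw [Finset.filter_true, Finset.coe_image, Finset.coe_univ, Set.image_univ] at hone
    rw [prob_compl_eq_zero_iff (Set.finite_range e).measurableSet, ← ENNReal.toReal_eq_one_iff,
      ← measureReal_def, hone]
    simp [cubeP, cubeE_const]
  rw [← hfin]
  rw [measureReal_def, measureReal_def, ← measure_inter_conull hnull]
  congr 2
  ext x
  simp only [Set.mem_inter_iff, Set.mem_range, Finset.coe_image, Set.mem_image, Finset.coe_filter,
    Finset.mem_univ, true_and]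
  constructor
  · rintro ⟨hx, S, rfl⟩
    exact ⟨S, hx, rfl⟩
  · rintro ⟨S, hS, rfl⟩
    exact ⟨hS, S, rfl⟩

end Transfer

theorem proposition6p6 :
    ∃ p : unitInterval, (0 < (p : ℝ) ∧ (p : ℝ) ≤ 1 / 2) ∧ (p : ℝ) = 1 / 3 ∧
      ∀ f ∈ allQuadPolys, ∀ ℓ : ℤ, 2 ≤ ℓ →
        probEq f.2 p (ℓ : ℝ) < 0.3293 ∧ (0.3293 : ℝ) < 0.33 := by
  classical
  refine ⟨⟨1 / 3, by norm_num, by norm_num⟩, ⟨by norm_num, by norm_num⟩, rfl, ?_⟩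
  rintro ⟨s, f⟩ ⟨-, hf⟩ ℓ hℓ
  refine ⟨?_, by norm_num⟩
  lift ℓ to ℕ using by omega
  have hle := (isQuad_monomialCount hf).cubeP_le (m := ℓ) (by omega)
  rw [probEq, bernoulliVector_real_eq_cubeP rfl]
  refine lt_of_le_of_lt ((cubeP_mono fun S _ hS => ?_).trans hle) (by norm_num)
  have hS' : MvPolynomial.eval (fun i => if i ∈ S then (1 : ℝ) else 0) f = ((ℓ : ℤ) : ℝ) := hS
  rw [eval_indicator hf, Int.cast_natCast, Nat.cast_inj] at hS'
  rw [monomialCount_empty hf, zero_add, hS']
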